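/- Let $\mathbb H$ be a real separable Hilbert space with norm $|\cdot|$ and inner product $\langle\cdot,\cdot\rangle$. Let $(U(t,s))_{t\ge s}$ be an evolution family of bounded linear operators on $\mathbb H$ (i.e. $U(s,s)=I$, $U(t,r)U(r,s)=U(t,s)$ for $s\le r\le t$, and $(t,s)\mapsto U(t,s)x$ is continuous on $\{t\ge s\}$ for every $x$), and let $(\mu_{t,s})_{t\ge s}$ be Borel probability measures on $\mathbb H$ satisfying $$\mu_{t,s}=\mu_{t,r}*\bigl(\mu_{r,s}\circ U(t,r)^{-1}\bigr),\qquad s\le r\le t .$$ Suppose that for all $t\ge s$ the measure $\mu_{t,s}$ is infinitely divisible with characteristic triplet $(a_{t,s},R_{t,s},\mathrm m_{t,s})$, where $a_{t,s}\in\mathbb H$, $R_{t,s}$ is a symmetric nonnegative trace class operator and $\mathrm m_{t,s}$ is a Lévy measure (that is, $\mathrm m_{t,s}(\{0\})=0$ and $\int \min(1,|x|^2)\,\mathrm m_{t,s}(dx)<\infty$); i.e. its Fourier transform is $\exp(-\psi_{t,s}(\xi))$ with $$\psi_{t,s}(\xi)=-i\langle a_{t,s},\xi\rangle+\tfrac12\langle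 \xi,R_{t,s}\xi\rangle-\int_{\mathbb H}\Bigl(e^{i\langle\xi,x\rangle}-1-\frac{i\langle\xi,x\rangle}{1+|x|^2}\Bigr)\mathrm m_{t,s}(dx).$$ For bounded Borel $f:\mathbb H\to\mathbb R$ put $p_{s,t}f(x)=\int_{\mathbb H} f(U(t,s)x+y)\,\mu_{t,s}(dy)$. Let $\Gamma_{t,s}=R_{t,s}^{-1/2}U(t,s)$ with domain $\mathscr D(\Gamma_{t,s})=\{x\in\mathbb H: U(t,s)x\in R_{t,s}^{1/2}(\mathbb H)\}$, where $R_{t,s}^{-1/2}$ is the pseudo-inverse of the positive square root $R_{t,s}^{1/2}$ (it sends $v$ to the preimage of $v$ of minimal norm). Then for all $t>s$, all bounded Borel $f:\mathbb H\to\mathbb R$ and all $x,y\in\mathbb H$ with $x-y\in\mathscr D(\Gamma_{t,s})$, $$|p_{s,t}f(x)-p_{s,t}f(y)|^2\le\bigl(e^{|\Gamma_{t,s}(x-y)|^2}-1\bigr)\,\min\bigl\{p_{s,t}f^2(z)-(p_{s,t}f(z))^2 : z=x,y\bigr\}.$$ (For $x-y\notin\mathscr D(\Gamma_{t,s})$ one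 sets $|\Gamma_{t,s}(x-y)|=\infty$ and the right-hand side is understood as $+\infty$, so that nothing is claimed.) -/

import Mathlib

open MeasureTheory
open scoped RealInnerProductSpace MeasureTheory

namespace Mehler

section SquareRoot

/-! ### The positive square root of a positive operator on a real Hilbert space -/

variable {H : Type*} [NormedAddCommGroup H] [InnerProductSpace ℝ H]

lemma norm_le_one_of_inner {T : H →L[ℝ] H} (hs : T.IsSymmetric)
    (h0 : ∀ x, 0 ≤ ⟪T x, x⟫) (h1 : ∀ x, ⟪T x, x⟫ ≤ ‖x‖ ^ 2) : ‖T‖ ≤ 1 := by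
  rw [ContinuousLinearMap.norm_eq_iSup_rayleighQuotient T hs]
  refine ciSup_le fun x => ?_
  have e : T.rayleighQuotient x = ⟪T x, x⟫ / ‖x‖ ^ 2 := rfl
  rw [e, abs_of_nonneg (div_nonneg (h0 x) (by positivity))]
  exact div_le_one_of_le₀ (h1 x) (by positivity)

/-- Taylor coefficients of `2 (1 - √(1 - x)) / x`. -/
noncomputable def sqrtCoeff (n : ℕ) : ℝ := (catalan n : ℝ) / 4 ^ n

lemma sqrtCoeff_nonneg (n : ℕ) : 0 ≤ sqrtCoeff n := by
  unfold sqrtCoeff; positivity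

lemma sqrtCoeff_zero : sqrtCoeff 0 = 1 := by simp [sqrtCoeff]

lemma sqrtCoeff_succ (n : ℕ) :
    sqrtCoeff (n + 1) =
      (1 / 4) * ∑ p ∈ Finset.HasAntidiagonal.antidiagonal n, sqrtCoeff p.1 * sqrtCoeff p.2 := by
  unfold sqrtCoeff
  rw [catalan_succ', Nat.cast_sum, Finset.sum_div, Finset.mul_sum]
  refine Finset.sum_congr rfl fun p hp => ?_
  rw [← Finset.HasAntidiagonal.mem_antidiagonal.1 hp]
  push_cast
  rw [pow_succ, pow_add]
  field_simp

lemma sum_sqrtCoeff_le (n : ℕ) : ∑ i ∈ Finset.range n, sqrtCoeff i ≤ 2 := by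
  induction n with
  | zero => simp
  | succ n ih =>
    rw [Finset.sum_range_succ', sqrtCoeff_zero]
    have h1 : ∑ i ∈ Finset.range n, sqrtCoeff (i + 1) ≤
        (1 / 4) * ((∑ i ∈ Finset.range n, sqrtCoeff i) * ∑ i ∈ Finset.range n, sqrtCoeff i) := by
      simp_rw [sqrtCoeff_succ]
      rw [← Finset.mul_sum, Finset.sum_mul_sum, ← Finset.sum_product', Finset.sum_sigma']
      refine mul_le_mul_of_nonneg_left ?_ (by norm_num)
      rw [← Finset.sum_image (g := fun x : (_ : ℕ) × ℕ × ℕ => x.2)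
        (f := fun p : ℕ × ℕ => sqrtCoeff p.1 * sqrtCoeff p.2)]
      · refine Finset.sum_le_sum_of_subset_of_nonneg ?_ fun p _ _ =>
          mul_nonneg (sqrtCoeff_nonneg _) (sqrtCoeff_nonneg _)
        intro p hp
        obtain ⟨x, hx, rfl⟩ := Finset.mem_image.1 hp
        simp only [Finset.mem_sigma, Finset.mem_range, Finset.HasAntidiagonal.mem_antidiagonal] at hx
        simp only [Finset.mem_product, Finset.mem_range]
        omega
      · rintro ⟨a, p⟩ ha ⟨b, q⟩ hb hpq
        simp only [Finset.coe_sigma, Set.mem_sigma_iff, Finset.mem_coe,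
          Finset.HasAntidiagonal.mem_antidiagonal] at ha hb hpq
        subst hpq
        obtain rfl : a = b := ha.2.symm.trans hb.2
        rfl
    have h0 : 0 ≤ ∑ i ∈ Finset.range n, sqrtCoeff i :=
      Finset.sum_nonneg fun i _ => sqrtCoeff_nonneg i
    nlinarith

lemma summable_sqrtCoeff : Summable sqrtCoeff :=
  summable_of_sum_range_le sqrtCoeff_nonneg sum_sqrtCoeff_le

lemma tsum_sqrtCoeff_le : ∑' n, sqrtCoeff n ≤ 2 :=
  Real.tsum_le_of_sum_range_le sqrtCoeff_nonneg sum_sqrtCoeff_le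

/-- The binomial series `∑ sqrtCoeff n • T ^ n`. -/
noncomputable def sqrtSeries (T : H →L[ℝ] H) : H →L[ℝ] H := ∑' n, sqrtCoeff n • T ^ n

lemma norm_pow_le_one {T : H →L[ℝ] H} (hT : ‖T‖ ≤ 1) (n : ℕ) : ‖T ^ n‖ ≤ 1 := by
  induction n with
  | zero => exact ContinuousLinearMap.norm_id_le (𝕜 := ℝ) (E := H)
  | succ n ih =>
    rw [pow_succ]
    exact (norm_mul_le _ _).trans (mul_le_one₀ ih (norm_nonneg _) hT)

lemma norm_term_le {T : H →L[ℝ] H} (hT : ‖T‖ ≤ 1) (n : ℕ) :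
    ‖sqrtCoeff n • T ^ n‖ ≤ sqrtCoeff n := by
  rw [norm_smul, Real.norm_of_nonneg (sqrtCoeff_nonneg n)]
  exact mul_le_of_le_one_right (sqrtCoeff_nonneg n) (norm_pow_le_one hT n)

lemma summable_norm_term {T : H →L[ℝ] H} (hT : ‖T‖ ≤ 1) :
    Summable fun n => ‖sqrtCoeff n • T ^ n‖ :=
  Summable.of_nonneg_of_le (fun _ => norm_nonneg _) (norm_term_le hT) summable_sqrtCoeff

lemma norm_sqrtSeries_le {T : H →L[ℝ] H} (hT : ‖T‖ ≤ 1) : ‖sqrtSeries T‖ ≤ 2 :=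
  (tsum_of_norm_bounded summable_sqrtCoeff.hasSum (norm_term_le hT)).trans tsum_sqrtCoeff_le

variable [CompleteSpace H]

lemma sqrtSeries_eq {T : H →L[ℝ] H} (hT : ‖T‖ ≤ 1) :
    sqrtSeries T = 1 + (1 / 4 : ℝ) • (T * (sqrtSeries T * sqrtSeries T)) := by
  have hs := summable_norm_term hT
  have hp : sqrtSeries T * sqrtSeries T =
      ∑' n, ∑ p ∈ Finset.HasAntidiagonal.antidiagonal n,
        (sqrtCoeff p.1 • T ^ p.1) * (sqrtCoeff p.2 • T ^ p.2) :=
    tsum_mul_tsum_eq_tsum_sum_antidiagonal_of_summable_norm hs hs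
  have hps := (summable_norm_sum_mul_antidiagonal_of_summable_norm hs hs).of_norm
  rw [hp, ← hps.tsum_mul_left, ← (hps.mul_left T).tsum_const_smul]
  conv_lhs => rw [sqrtSeries, hs.of_norm.tsum_eq_zero_add]
  congr 1
  · simp [sqrtCoeff_zero]
  · refine tsum_congr fun n => ?_
    rw [sqrtCoeff_succ, Finset.mul_sum, Finset.mul_sum, Finset.sum_smul, Finset.smul_sum]
    refine Finset.sum_congr rfl fun p hp => ?_
    rw [← Finset.HasAntidiagonal.mem_antidiagonal.1 hp]
    simp only [smul_mul_assoc, mul_smul_comm, smul_smul]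
    rw [← pow_add, pow_succ', mul_comm (sqrtCoeff p.1)]

lemma isSelfAdjoint_sqrtSeries {T : H →L[ℝ] H} (h : IsSelfAdjoint T) :
    IsSelfAdjoint (sqrtSeries T) := by
  unfold sqrtSeries
  rw [IsSelfAdjoint, tsum_star]
  exact tsum_congr fun n => ((IsSelfAdjoint.all (sqrtCoeff n)).smul (h.pow n)).star_eq

lemma commute_sqrtSeries {A T : H →L[ℝ] H} (h : Commute A T) (hT : ‖T‖ ≤ 1) :
    Commute A (sqrtSeries T) := by
  have hs := (summable_norm_term hT).of_norm
  unfold sqrtSeries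
  rw [Commute, SemiconjBy, ← hs.tsum_mul_left, ← hs.tsum_mul_right]
  exact tsum_congr fun n => ((h.pow_right n).smul_right (sqrtCoeff n)).eq

/-- A positive operator has a positive square root, commuting with everything that commutes
with the operator. -/
lemma exists_sqrt {R : H →L[ℝ] H} (hR : R.IsPositive) :
    ∃ S : H →L[ℝ] H, S.IsPositive ∧ S ∘L S = R ∧ ∀ A : H →L[ℝ] H, Commute A R → Commute A S := by
  set c : ℝ := ‖R‖ + 1 with hc
  have hc0 : 0 < c := by positivity
  set T : H →L[ℝ] H := 1 - c⁻¹ • R with hTdef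
  have hTa : IsSelfAdjoint T :=
    (IsSelfAdjoint.one _).sub ((IsSelfAdjoint.all c⁻¹).smul hR.isSelfAdjoint)
  have hin : ∀ x, ⟪T x, x⟫ = ‖x‖ ^ 2 - c⁻¹ * ⟪R x, x⟫ := by
    intro x
    simp [hTdef, inner_sub_left, real_inner_smul_left]
  have hT : ‖T‖ ≤ 1 := by
    refine norm_le_one_of_inner hTa.isSymmetric (fun x => ?_) (fun x => ?_)
    · rw [hin, sub_nonneg, inv_mul_le_iff₀ hc0]
      calc ⟪R x, x⟫ ≤ ‖R x‖ * ‖x‖ := real_inner_le_norm _ _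
        _ ≤ (‖R‖ * ‖x‖) * ‖x‖ := by gcongr; exact R.le_opNorm x
        _ ≤ c * ‖x‖ ^ 2 := by rw [hc]; nlinarith [sq_nonneg ‖x‖]
    · rw [hin]
      have : 0 ≤ c⁻¹ * ⟪R x, x⟫ := mul_nonneg (by positivity) (hR.inner_nonneg_left x)
      linarith
  set V := sqrtSeries T with hV
  have hTV : Commute T V := commute_sqrtSeries (Commute.refl T) hT
  have hVa : IsSelfAdjoint V := isSelfAdjoint_sqrtSeries hTa
  have hVe : V = 1 + (1 / 4 : ℝ) • (T * (V * V)) := sqrtSeries_eq hT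
  set W : H →L[ℝ] H := 1 - (1 / 2 : ℝ) • (T * V) with hW
  have hTVa : IsSelfAdjoint (T * V) := (IsSelfAdjoint.commute_iff hTa hVa).1 hTV
  have hWa : IsSelfAdjoint W :=
    (IsSelfAdjoint.one _).sub ((IsSelfAdjoint.all (1 / 2 : ℝ)).smul hTVa)
  have hTVn : ‖T * V‖ ≤ 2 := by
    refine (norm_mul_le _ _).trans ?_
    have := norm_sqrtSeries_le hT
    nlinarith [norm_nonneg T, norm_nonneg V]
  have hWW : W * W = c⁻¹ • R := by
    have e1 : T * V * (T * V) = T * (T * (V * V)) := by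
      rw [mul_assoc, ← mul_assoc V T V, ← hTV.eq, mul_assoc T V V]
    have e2 : (1 / 4 : ℝ) • (T * (V * V)) = V - 1 := by rw [eq_sub_iff_add_eq', ← hVe]
    have e3 : (1 / 4 : ℝ) • (T * V * (T * V)) = T * V - T := by
      rw [e1, ← mul_smul_comm, e2, mul_sub, mul_one]
    have e4 : W * W = 1 - T * V + (1 / 4 : ℝ) • (T * V * (T * V)) := by
      rw [hW, sub_mul, mul_sub, mul_sub, one_mul, mul_one, one_mul, smul_mul_smul_comm]
      have : (1 / 2 : ℝ) * (1 / 2) = 1 / 4 := by norm_num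
      rw [this]
      module
    rw [e4, e3, hTdef]
    abel
  refine ⟨Real.sqrt c • W, ?_, ?_, ?_⟩
  · rw [ContinuousLinearMap.isPositive_def']
    refine ⟨(IsSelfAdjoint.all _).smul hWa, fun x => ?_⟩
    have : ⟪(Real.sqrt c • W) x, x⟫ = Real.sqrt c * (‖x‖ ^ 2 - 1 / 2 * ⟪(T * V) x, x⟫) := by
      simp [hW, inner_sub_left, real_inner_smul_left]
    change 0 ≤ ⟪(Real.sqrt c • W) x, x⟫
    rw [this]
    refine mul_nonneg (Real.sqrt_nonneg _) ?_
    have : ⟪(T * V) x, x⟫ ≤ 2 * ‖x‖ ^ 2 :=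
      calc ⟪(T * V) x, x⟫ ≤ ‖(T * V) x‖ * ‖x‖ := real_inner_le_norm _ _
        _ ≤ (2 * ‖x‖) * ‖x‖ := by gcongr; exact (T * V).le_of_opNorm_le hTVn x
        _ = 2 * ‖x‖ ^ 2 := by ring
    linarith
  · change (Real.sqrt c • W) * (Real.sqrt c • W) = R
    rw [smul_mul_smul_comm, hWW, Real.mul_self_sqrt hc0.le, smul_smul, mul_inv_cancel₀ hc0.ne',
      one_smul]
  · intro A hA
    have hAT : Commute A T := (Commute.one_right A).sub_right (hA.smul_right c⁻¹)
    have hAV : Commute A V := commute_sqrtSeries hAT hT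
    exact ((Commute.one_right A).sub_right ((hAT.mul_right hAV).smul_right _)).smul_right _

lemma apply_eq_zero_of_inner {A : H →L[ℝ] H} (hA : A.IsPositive) {w : H}
    (h : ⟪A w, w⟫ = 0) : A w = 0 := by
  obtain ⟨S, hS, hSS, -⟩ := exists_sqrt hA
  have e : ∀ v, A v = S (S v) := fun v => by rw [← hSS]; rfl
  rw [e, hS.inner_left_eq_inner_right, inner_self_eq_zero] at h
  rw [e, h, map_zero]

/-- The positive square root of a positive operator is unique. -/
lemma sqrt_unique {A B : H →L[ℝ] H} (hA : A.IsPositive) (hB : B.IsPositive)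
    (h : A ∘L A = B ∘L B) : A = B := by
  obtain ⟨S, hS, hSS, hcomm⟩ := exists_sqrt
    (R := A ∘L A) (by simpa [hA.isSelfAdjoint.adjoint_eq] using
      ContinuousLinearMap.isPositive_adjoint_comp_self A)
  have key : ∀ C : H →L[ℝ] H, C.IsPositive → C ∘L C = S ∘L S → C = S := by
    intro C hC hCS
    have hCc : Commute C S := hcomm C (by
      rw [← hSS, ← hCS]
      exact (Commute.refl C).mul_right (Commute.refl C))
    have hz : (C + S) * (C - S) = 0 := by
      have : C * C = S * S := hCS
      rw [add_mul, mul_sub, mul_sub, this, hCc.eq]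
      abel
    ext v
    set w := (C - S) v with hw
    have h1 : (C + S) w = 0 := by
      have := congrArg (fun L : H →L[ℝ] H => L v) hz
      exact this
    have h2 : ⟪C w, w⟫ + ⟪S w, w⟫ = 0 := by
      rw [← inner_add_left, ← add_apply, h1, inner_zero_left]
    have h3 := hC.inner_nonneg_left w
    have h4 := hS.inner_nonneg_left w
    have h5 : C w = 0 := apply_eq_zero_of_inner hC (by linarith)
    have h6 : S w = 0 := apply_eq_zero_of_inner hS (by linarith)
    have h7 : ⟪w, w⟫ = 0 := by
      have : ⟪(C - S) v, w⟫ = 0 := by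
        rw [sub_apply, inner_sub_left, hC.inner_left_eq_inner_right,
          hS.inner_left_eq_inner_right, h5, h6, sub_self]
      exact this
    have h8 : w = 0 := inner_self_eq_zero.1 h7
    rw [hw, sub_apply, sub_eq_zero] at h8
    exact h8
  rw [key A hA hSS.symm, key B hB (h.symm.trans hSS.symm)]

open Classical in
/-- The positive square root `R^{1/2}` of a positive bounded operator `R` (with the value `0` if
`R` is not positive). -/
noncomputable def sqrtOp (R : H →L[ℝ] H) : H →L[ℝ] H :=
  if h : R.IsPositive then (exists_sqrt h).choose else 0

lemma sqrtOp_isPositive {R : H →L[ℝ] H} (hR : R.IsPositive) : (sqrtOp R).IsPositive := by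
  rw [sqrtOp, dif_pos hR]; exact (exists_sqrt hR).choose_spec.1

lemma sqrtOp_comp_self {R : H →L[ℝ] H} (hR : R.IsPositive) : sqrtOp R ∘L sqrtOp R = R := by
  rw [sqrtOp, dif_pos hR]; exact (exists_sqrt hR).choose_spec.2.1

lemma eq_sqrtOp {R S : H →L[ℝ] H} (hS : S.IsPositive) (h : S ∘L S = R) : S = sqrtOp R := by
  have hR : R.IsPositive := by
    rw [← h]
    simpa [hS.isSelfAdjoint.adjoint_eq] using ContinuousLinearMap.isPositive_adjoint_comp_self S
  exact sqrt_unique hS (sqrtOp_isPositive hR) (h.trans (sqrtOp_comp_self hR).symm)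

end SquareRoot

section PseudoInverse

/-! ### The pseudo-inverse -/

variable {H : Type*} [NormedAddCommGroup H] [InnerProductSpace ℝ H]

open Classical in
/-- The pseudo-inverse `S⁻¹ v` of a bounded operator `S`, for `v` in the range of `S`: the unique
preimage of `v` in the orthogonal complement of the kernel of `S`, equivalently the preimage of
minimal norm (with the value `0` if `v` is not in the range of `S`). -/
noncomputable def pinv (S : H →L[ℝ] H) (v : H) : H :=
  if h : ∃ z, z ∈ S.kerᗮ ∧ S z = v then h.choose else 0

lemma exists_preimage_mem_orthogonal [CompleteSpace H] {S : H →L[ℝ] H} {v : H}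
    (hv : v ∈ Set.range S) : ∃ z, z ∈ S.kerᗮ ∧ S z = v := by
  obtain ⟨u, rfl⟩ := hv
  have : CompleteSpace S.ker := S.isClosed_ker.completeSpace_coe
  refine ⟨u - S.ker.starProjection u,
    Submodule.sub_starProjection_mem_orthogonal u, ?_⟩
  have h : S (S.ker.starProjection u) = 0 :=
    LinearMap.mem_ker.1 (Submodule.starProjection_apply_mem S.ker u)
  rw [map_sub, h, sub_zero]

lemma pinv_mem_orthogonal [CompleteSpace H] {S : H →L[ℝ] H} {v : H} (hv : v ∈ Set.range S) :
    pinv S v ∈ S.kerᗮ := by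
  have h := exists_preimage_mem_orthogonal hv
  rw [pinv, dif_pos h]; exact h.choose_spec.1

lemma apply_pinv [CompleteSpace H] {S : H →L[ℝ] H} {v : H} (hv : v ∈ Set.range S) :
    S (pinv S v) = v := by
  have h := exists_preimage_mem_orthogonal hv
  rw [pinv, dif_pos h]; exact h.choose_spec.2

lemma norm_pinv_le [CompleteSpace H] {S : H →L[ℝ] H} {v z : H} (hz : S z = v) :
    ‖pinv S v‖ ≤ ‖z‖ := by
  have hv : v ∈ Set.range S := ⟨z, hz⟩
  have hk : z - pinv S v ∈ S.ker := by
    rw [LinearMap.mem_ker, map_sub, sub_eq_zero]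
    exact hz.trans (apply_pinv hv).symm
  have ho : ⟪pinv S v, z - pinv S v⟫ = 0 :=
    Submodule.inner_left_of_mem_orthogonal hk (pinv_mem_orthogonal hv)
  have h := norm_add_sq_eq_norm_sq_add_norm_sq_real ho
  rw [add_sub_cancel] at h
  nlinarith [norm_nonneg z, norm_nonneg (pinv S v), norm_nonneg (z - pinv S v)]

end PseudoInverse

section Semigroup

variable {H : Type*} [NormedAddCommGroup H] [InnerProductSpace ℝ H]

/-- `(U t s)_{t ≥ s}` is an evolution family: a strongly continuous two-parameter family of bounded
operators with `U s s = I` and `U t r U r s = U t s`. Only the values with `s ≤ t` matter. -/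
structure IsEvolutionFamily (U : ℝ → ℝ → H →L[ℝ] H) : Prop where
  refl : ∀ s, U s s = ContinuousLinearMap.id ℝ H
  comp : ∀ s r t, s ≤ r → r ≤ t → U t r ∘L U r s = U t s
  continuousOn : ∀ x, ContinuousOn (fun p : ℝ × ℝ => U p.1 p.2 x) {p | p.2 ≤ p.1}

/-- A covariance operator: symmetric, nonnegative, and of trace class (for a nonnegative operator:
`∑ ⟪R e, e⟫` is bounded over all finite orthonormal systems `e`). -/
structure IsCovarianceOp (R : H →L[ℝ] H) : Prop where
  isPositive : R.IsPositive
  traceClass : ∃ C : ℝ, ∀ (n : ℕ) (e : Fin n → H), Orthonormal ℝ e → ∑ i, ⟪R (e i), e i⟫ ≤ C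

variable [MeasurableSpace H]

/-- A Lévy measure on `H`: no mass at `0`, and `∫ min(1, |x|²) m(dx) < ∞`. -/
structure IsLevyMeasure (m : Measure H) : Prop where
  zero : m {0} = 0
  lintegral_lt_top : ∫⁻ x, ENNReal.ofReal (min 1 (‖x‖ ^ 2)) ∂m < ⊤

/-- The symbol
`ψ(ξ) = -i⟨a, ξ⟩ + ½⟨ξ, Rξ⟩ - ∫ (exp(i⟨ξ, x⟩) - 1 - i⟨ξ, x⟩ / (1 + |x|²)) m(dx)`. -/
noncomputable def levySymbol (a : H) (R : H →L[ℝ] H) (m : Measure H) (ξ : H) : ℂ :=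
  -(Complex.I * (⟪a, ξ⟫ : ℝ)) + (1 / 2 : ℂ) * (⟪ξ, R ξ⟫ : ℝ)
    - ∫ x, (Complex.exp (Complex.I * (⟪ξ, x⟫ : ℝ)) - 1
        - Complex.I * (⟪ξ, x⟫ : ℝ) / (1 + (‖x‖ : ℂ) ^ 2)) ∂m

/-- `μ = D[a, R, m]`: `μ` is the (infinitely divisible) probability measure on `H` with Fourier
transform `exp(-ψ)`, where `ψ` is the symbol with characteristic triplet `(a, R, m)`. -/
structure HasLevyTriplet (μ : Measure H) (a : H) (R : H →L[ℝ] H) (m : Measure H) : Prop where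
  isProbabilityMeasure : IsProbabilityMeasure μ
  isCovarianceOp : IsCovarianceOp R
  isLevyMeasure : IsLevyMeasure m
  charFun_eq : ∀ ξ, charFun μ ξ = Complex.exp (-levySymbol a R m ξ)

/-- The skew convolution equation `μ t s = μ t r * (μ r s ∘ U(t, r)⁻¹)` for `s ≤ r ≤ t`. -/
def IsSkewConvolution (U : ℝ → ℝ → H →L[ℝ] H) (μ : ℝ → ℝ → Measure H) : Prop :=
  ∀ s r t, s ≤ r → r ≤ t → μ t s = (μ t r) ∗ ((μ r s).map (U t r))

/-- The generalized Mehler operator `p_{s,t} f(x) = ∫ f(U(t, s) x + y) μ_{t,s}(dy)`. -/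
noncomputable def mehler (U : ℝ → ℝ → H →L[ℝ] H) (μ : ℝ → ℝ → Measure H) (s t : ℝ)
    (f : H → ℝ) (x : H) : ℝ :=
  ∫ y, f (U t s x + y) ∂(μ t s)

end Semigroup

section Gamma

variable {H : Type*} [NormedAddCommGroup H] [InnerProductSpace ℝ H] [CompleteSpace H]

/-- The domain of `Γ_{t,s} = R_{t,s}^{-1/2} U(t, s)`: all `x` with `U(t, s) x` in the range of
`R_{t,s}^{1/2}`. -/
def gammaDomain (U R : ℝ → ℝ → H →L[ℝ] H) (t s : ℝ) : Set H :=
  {x | U t s x ∈ Set.range (sqrtOp (R t s))}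

/-- `Γ_{t,s} x = R_{t,s}^{-1/2} U(t, s) x` for `x` in the domain, `R_{t,s}^{-1/2}` being the
pseudo-inverse of `R_{t,s}^{1/2}`. -/
noncomputable def gammaOp (U R : ℝ → ℝ → H →L[ℝ] H) (t s : ℝ) (x : H) : H :=
  pinv (sqrtOp (R t s)) (U t s x)

end Gamma

end Mehler

/-! ### Entrywise exponentials of positive semidefinite matrices -/

section PositiveSemidefinite

open Matrix ComplexConjugate
open scoped ComplexOrder MatrixOrder

/-! Write `μ` for `μ t s`, `S` for the square root of `R t s`, and `k` for `Γ(x - y)`. Since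
`U(t,s)(x - y) = S k`, the claim compares integrals against `μ` with integrals against its translate
by `S k`, and on the Fourier side this translation multiplies `μ̂(ξ)` by the phase `exp(i⟨S k, ξ⟩)`.

By the Lévy–Khintchine formula, `μ̂(η - ξ) = conj(μ̂ ξ) μ̂(η) exp(K(ξ, η))` with `K(ξ, η) = ⟨S ξ, S
η⟩ + ∫ conj(e^{i⟨ξ,x⟩} - 1)(e^{i⟨η,x⟩} - 1) m(dx)`, a positive semidefinite kernel (`charFun_sub`,
`posSemidef_levyKernel`). Hence the covariance of two characters under `μ` is `conj(μ̂ ξ) μ̂(η) (e^K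
- 1)`. Adjoin to the matrix of `K` one index carrying the vector `k` in the Gaussian part and
nothing in the jump part, with a phase making its row `i⟨k, S ξ⟩`. The matrix stays positive
semidefinite, and so does its entrywise `exp - 1` by the Schur product theorem (`map_exp_sub_one`).
Cauchy–Schwarz for the new index (`norm_sum_none_sq_le`) is then the desired inequality for
trigonometric polynomials (`norm_sum_charFun_sq_le`), the factor `exp(‖k‖²) - 1` being the new
diagonal entry.

Trigonometric polynomials are dense in `L²(μ + μ')`, with `μ'` the translate, and both sides are
continuous there, so the estimate extends to bounded Borel functions without first proving `μ' ≪ μ`.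
Exchanging `x` and `y` gives the minimum of the two variances. -/

lemma Matrix.PosSemidef.map_pow {ι : Type*} {M : Matrix ι ι ℂ} (hM : M.PosSemidef) (k : ℕ) :
    (M.map fun z => z ^ (k + 1)).PosSemidef := by
  induction k with
  | zero => simpa using hM
  | succ k ih =>
    -- Schur product theorem.
    have h := ih.hadamard hM
    have e : (M.map fun z => z ^ (k + 1)) ⊙ M = M.map fun z => z ^ (k + 1 + 1) := by
      ext i j
      simp [pow_succ]
    rwa [e] at h

/-- The entrywise function `exp - 1` preserves positive semidefiniteness. -/
lemma Matrix.PosSemidef.map_exp_sub_one {ι : Type*} {M : Matrix ι ι ℂ} (hM : M.PosSemidef) :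
    (M.map fun z => Complex.exp z - 1).PosSemidef := by
  -- Subtracting `1` removes the constant term, so only powers `k + 1 ≥ 1` with positive
  -- coefficients remain.
  have hs : ∀ z : ℂ, HasSum (fun k : ℕ => ((k + 1).factorial : ℂ)⁻¹ * z ^ (k + 1))
      (Complex.exp z - 1) := by
    intro z
    have h := NormedSpace.expSeries_div_hasSum_exp z
    rw [← Complex.exp_eq_exp_ℂ, ← hasSum_nat_add_iff' 1] at h
    simpa [div_eq_inv_mul] using h
  refine ⟨?_, fun x => ?_⟩
  · ext i j
    simp only [conjTranspose_apply, map_apply, star_sub, star_one, Complex.star_def,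
      ← Complex.exp_conj]
    rw [← Complex.star_def, hM.1.apply]
  · have h : HasSum (fun k : ℕ => ((k + 1).factorial : ℂ)⁻¹ * x.sum fun i xi =>
        x.sum fun j xj => star xi * (M.map fun z => z ^ (k + 1)) i j * xj)
        (x.sum fun i xi => x.sum fun j xj =>
          star xi * (M.map fun z => Complex.exp z - 1) i j * xj) := by
      simp only [Finsupp.sum, Finset.mul_sum]
      refine hasSum_sum fun i _ => hasSum_sum fun j _ => ?_
      have h1 := ((hs (M i j)).mul_left (star (x i))).mul_right (x j)
      simp only [map_apply]
      refine (congrArg (HasSum · _) (funext fun k => ?_)).mpr h1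
      ring
    refine h.nonneg fun k => mul_nonneg ?_ ((hM.map_pow k).2 x)
    rw [← Complex.ofReal_natCast, ← Complex.ofReal_inv]
    exact Complex.zero_le_real.2 (by positivity)

/-- A real factorization `M = Bᵀ B` remains a factorization after casting the entries to `ℂ`. -/
lemma Matrix.PosSemidef.map_ofReal {ι : Type*} [Fintype ι] {M : Matrix ι ι ℝ}
    (hM : M.PosSemidef) : (M.map fun r => (r : ℂ)).PosSemidef := by
  classical
  obtain ⟨B, rfl⟩ := CStarAlgebra.nonneg_iff_eq_star_mul_self.mp hM.nonneg
  have e : (star B * B).map (fun r => (r : ℂ)) =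
      (B.map fun r => (r : ℂ))ᴴ * B.map fun r => (r : ℂ) := by
    ext i j
    simp [mul_apply, star_eq_conjTranspose]
  rw [e]
  exact posSemidef_conjTranspose_mul_self _

/-- Cauchy–Schwarz inequality for a positive semidefinite matrix with a distinguished index. -/
lemma Matrix.PosSemidef.norm_sum_none_sq_le {ι : Type*} [Fintype ι]
    {M : Matrix (Option ι) (Option ι) ℂ} (hM : M.PosSemidef) (w : ι → ℂ) :
    ‖∑ j, M none (some j) * w j‖ ^ 2 ≤
      (M none none).re * (∑ i, ∑ j, conj (w i) * M (some i) (some j) * w j).re := by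
  set A := ∑ j, M none (some j) * w j with hA
  set Q := ∑ i, ∑ j, conj (w i) * M (some i) (some j) * w j with hQ
  have hc : conj A = ∑ j, conj (w j) * M (some j) none := by
    rw [hA, map_sum]
    refine Finset.sum_congr rfl fun j _ => ?_
    rw [map_mul, mul_comm, ← hM.1.apply (some j) none, Complex.star_def]
  have h0 : 0 ≤ (M none none).re := (Complex.nonneg_iff.1 (hM.diag_nonneg (i := none))).1
  -- Test the form on the vector with entry `r A` at the distinguished index and `w` elsewhere.
  -- Scaling by `A` makes both cross terms equal to `r ‖A‖²`, leaving a real quadratic in `r` whose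
  -- discriminant gives the bound multiplied by `‖A‖²`.
  have key : ∀ r : ℝ, 0 ≤ (M none none).re * ‖A‖ ^ 2 * (r * r) + 2 * ‖A‖ ^ 2 * r + Q.re := by
    intro r
    have h := hM.dotProduct_mulVec_nonneg (fun o => o.elim (r * A) w)
    have e : star (fun o : Option ι => o.elim (r * A) w) ⬝ᵥ
        (M *ᵥ fun o => o.elim (r * A) w) =
        conj (r * A) * (M none none * (r * A) + A) + (conj A * (r * A) + Q) := by
      simp only [dotProduct, mulVec, Fintype.sum_option, Pi.star_apply, Option.elim]
      rw [hc, Finset.sum_mul, hQ, ← Finset.sum_add_distrib, hA]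
      congr 1
      refine Finset.sum_congr rfl fun i _ => ?_
      rw [mul_add, ← mul_assoc]
      simp only [Complex.star_def, Finset.mul_sum, mul_assoc]
    rw [e] at h
    have h2 := (Complex.nonneg_iff.1 h).1
    have e2 : conj (r * A) * (M none none * (r * A) + A) + (conj A * (r * A) + Q) =
        (r * r : ℝ) * (‖A‖ ^ 2 : ℝ) * M none none + (2 * r * ‖A‖ ^ 2 : ℝ) + Q := by
      have := Complex.conj_mul' A
      push_cast
      rw [← this, map_mul, Complex.conj_ofReal]
      ring
    rw [e2] at h2
    simp only [Complex.add_re, ← Complex.ofReal_mul, Complex.re_ofReal_mul,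
      Complex.ofReal_re] at h2
    nlinarith
  have hQ0 : 0 ≤ Q.re := by simpa using key 0
  rcases eq_or_ne A 0 with h | h
  · rw [h]; simpa using mul_nonneg h0 hQ0
  · have hd := discrim_le_zero key
    have hp : 0 < ‖A‖ ^ 2 := by positivity
    rw [discrim] at hd
    by_contra! hlt
    nlinarith

end PositiveSemidefinite

namespace Mehler
-- The positive semidefinite kernel of a Lévy–Khintchine exponent
section LevyKernel

open ComplexConjugate

variable {H : Type*} [NormedAddCommGroup H] [InnerProductSpace ℝ H]

/-- The integrand of the jump part of the Lévy symbol. -/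
noncomputable def levyIntegrand (ξ x : H) : ℂ :=
  Complex.exp (Complex.I * (⟪ξ, x⟫ : ℝ)) - 1 - Complex.I * (⟪ξ, x⟫ : ℝ) / (1 + (‖x‖ : ℂ) ^ 2)

/-- The centred character `x ↦ exp(i⟨ξ, x⟩) - 1`. -/
noncomputable def charSubOne (ξ x : H) : ℂ := Complex.exp (Complex.I * (⟪ξ, x⟫ : ℝ)) - 1

lemma norm_charSubOne_le_abs (ξ x : H) : ‖charSubOne ξ x‖ ≤ ‖ξ‖ * ‖x‖ :=
  Real.norm_exp_I_mul_ofReal_sub_one_le.trans (abs_real_inner_le_norm ξ x)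

lemma norm_charSubOne_le_two (ξ x : H) : ‖charSubOne ξ x‖ ≤ 2 := by
  refine (norm_sub_le _ _).trans ?_
  rw [Complex.norm_exp_I_mul_ofReal]
  norm_num

lemma norm_charSubOne_sq_le (ξ x : H) :
    ‖charSubOne ξ x‖ ^ 2 ≤ (4 + ‖ξ‖ ^ 2) * min 1 (‖x‖ ^ 2) := by
  have h1 := norm_charSubOne_le_abs ξ x
  have h2 := norm_charSubOne_le_two ξ x
  have h0 := norm_nonneg (charSubOne ξ x)
  rcases min_cases 1 (‖x‖ ^ 2) with h | h <;> rw [h.1]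
  · nlinarith [sq_nonneg ‖ξ‖]
  · have : ‖charSubOne ξ x‖ ^ 2 ≤ (‖ξ‖ * ‖x‖) ^ 2 := by gcongr
    nlinarith [sq_nonneg ‖x‖]

lemma norm_exp_I_mul_sub_one_sub_le (u : ℝ) :
    ‖Complex.exp (Complex.I * u) - 1 - Complex.I * u‖ ≤ 3 * u ^ 2 := by
  rcases le_total |u| 1 with h | h
  · have := Complex.norm_exp_sub_one_sub_id_le (x := Complex.I * u) (by simpa using h)
    have e : ‖Complex.I * (u : ℂ)‖ ^ 2 = u ^ 2 := by simp
    rw [e] at this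
    nlinarith [sq_nonneg u]
  · have h1 : ‖Complex.exp (Complex.I * u) - 1‖ ≤ |u| := Real.norm_exp_I_mul_ofReal_sub_one_le
    have h2 : ‖Complex.I * (u : ℂ)‖ = |u| := by simp
    have := norm_sub_le (Complex.exp (Complex.I * u) - 1) (Complex.I * u)
    rw [← sq_abs]
    nlinarith

/-- For `‖x‖ ≥ 1` the centred character is at most `2` and the compensator at most `‖ξ‖`. For `‖x‖ ≤
1` the second-order Taylor bound applies, and replacing `i⟨ξ, x⟩` by the compensator costs at most
`‖ξ‖ ‖x‖²`. -/
lemma norm_levyIntegrand_le (ξ x : H) :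
    ‖levyIntegrand ξ x‖ ≤ (2 + ‖ξ‖ + 3 * ‖ξ‖ ^ 2) * min 1 (‖x‖ ^ 2) := by
  set u : ℝ := ⟪ξ, x⟫ with hu
  have hux : |u| ≤ ‖ξ‖ * ‖x‖ := abs_real_inner_le_norm ξ x
  have hx0 := norm_nonneg x
  have hξ0 := norm_nonneg ξ
  have hpos : 0 < 1 + ‖x‖ ^ 2 := by positivity
  have hne : (1 + (‖x‖ : ℂ) ^ 2) ≠ 0 := by exact_mod_cast hpos.ne'
  rcases min_cases 1 (‖x‖ ^ 2) with h | h <;> rw [h.1]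
  · have h1 : ‖Complex.I * (u : ℂ) / (1 + (‖x‖ : ℂ) ^ 2)‖ ≤ ‖ξ‖ := by
      have e : (1 + (‖x‖ : ℂ) ^ 2) = ((1 + ‖x‖ ^ 2 : ℝ) : ℂ) := by push_cast; rfl
      rw [e, norm_div, Complex.norm_of_nonneg hpos.le, norm_mul, Complex.norm_I, one_mul,
        Complex.norm_real, div_le_iff₀ hpos, Real.norm_eq_abs]
      nlinarith [sq_nonneg (‖x‖ - 1)]
    have h2 := norm_charSubOne_le_two ξ x
    have := norm_sub_le (charSubOne ξ x) (Complex.I * (u : ℂ) / (1 + (‖x‖ : ℂ) ^ 2))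
    change ‖levyIntegrand ξ x‖ ≤ _ at this
    nlinarith [sq_nonneg ‖ξ‖]
  · have hx1 : ‖x‖ ≤ 1 := by nlinarith
    have e : levyIntegrand ξ x = (Complex.exp (Complex.I * u) - 1 - Complex.I * u) +
        ((u * (‖x‖ ^ 2 / (1 + ‖x‖ ^ 2)) : ℝ) : ℂ) * Complex.I := by
      unfold levyIntegrand
      push_cast
      field_simp
      ring
    rw [e]
    have h1 := norm_exp_I_mul_sub_one_sub_le u
    have h2 : ‖((u * (‖x‖ ^ 2 / (1 + ‖x‖ ^ 2)) : ℝ) : ℂ) * Complex.I‖ ≤ ‖ξ‖ * ‖x‖ ^ 2 := by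
      rw [norm_mul, Complex.norm_I, mul_one, Complex.norm_real, norm_mul, Real.norm_eq_abs,
        Real.norm_of_nonneg (by positivity)]
      have h3 : |u| ≤ ‖ξ‖ := by nlinarith
      have h4 : ‖x‖ ^ 2 / (1 + ‖x‖ ^ 2) ≤ ‖x‖ ^ 2 :=
        div_le_self (by positivity) (by linarith [sq_nonneg ‖x‖])
      gcongr
    have h5 : u ^ 2 ≤ ‖ξ‖ ^ 2 * ‖x‖ ^ 2 := by
      rw [← sq_abs, ← mul_pow]
      gcongr
    have := norm_add_le (Complex.exp (Complex.I * u) - 1 - Complex.I * u)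
      (((u * (‖x‖ ^ 2 / (1 + ‖x‖ ^ 2)) : ℝ) : ℂ) * Complex.I)
    nlinarith [sq_nonneg ‖x‖]

/-- The compensators cancel because they are real-linear in the frequency and purely imaginary. -/
lemma conj_charSubOne_mul_charSubOne (ξ η x : H) :
    conj (charSubOne ξ x) * charSubOne η x =
      levyIntegrand (η - ξ) x - conj (levyIntegrand ξ x) - levyIntegrand η x := by
  unfold charSubOne levyIntegrand
  rw [inner_sub_left]
  have e : Complex.exp (Complex.I * ((⟪η, x⟫ - ⟪ξ, x⟫ : ℝ) : ℂ)) =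
      Complex.exp (-(Complex.I * (⟪ξ, x⟫ : ℝ))) * Complex.exp (Complex.I * (⟪η, x⟫ : ℝ)) := by
    rw [← Complex.exp_add]
    push_cast
    ring_nf
  rw [e]
  simp only [map_sub, map_one, map_mul, map_div₀, map_add, map_pow, Complex.conj_ofReal,
    Complex.conj_I, ← Complex.exp_conj, Complex.ofReal_sub, neg_mul]
  ring

lemma continuous_charSubOne (ξ : H) : Continuous (charSubOne ξ) := by
  unfold charSubOne; fun_prop

lemma continuous_levyIntegrand (ξ : H) : Continuous (levyIntegrand ξ) := by
  unfold levyIntegrand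
  have : ∀ x : H, (1 + (‖x‖ : ℂ) ^ 2) ≠ 0 := fun x => by
    have : 0 < 1 + ‖x‖ ^ 2 := by positivity
    exact_mod_cast this.ne'
  fun_prop (disch := assumption)

variable [MeasurableSpace H] [BorelSpace H] [SecondCountableTopology H]

variable {m : Measure H}

omit [InnerProductSpace ℝ H] in
lemma IsLevyMeasure.integrable_min (hm : IsLevyMeasure m) :
    Integrable (fun x : H => min 1 (‖x‖ ^ 2)) m := by
  refine ⟨by fun_prop, ?_⟩
  rw [hasFiniteIntegral_iff_ofReal (Filter.Eventually.of_forall fun x => by positivity)]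
  exact hm.lintegral_lt_top

lemma IsLevyMeasure.integrable_levyIntegrand (hm : IsLevyMeasure m) (ξ : H) :
    Integrable (levyIntegrand ξ) m :=
  (hm.integrable_min.const_mul _).mono' (continuous_levyIntegrand ξ).aestronglyMeasurable
    (Filter.Eventually.of_forall (norm_levyIntegrand_le ξ))

/-- A Lévy measure may be infinite near `0`, but there `|e^{i⟨ξ,x⟩} - 1|² ≤ ‖ξ‖² ‖x‖²`. This places
the centred characters in a Hilbert space where their Gram matrix makes sense. -/
lemma IsLevyMeasure.memLp_charSubOne (hm : IsLevyMeasure m) (ξ : H) :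
    MemLp (charSubOne ξ) 2 m := by
  refine (memLp_two_iff_integrable_sq_norm
    (continuous_charSubOne ξ).aestronglyMeasurable).2 ?_
  refine (hm.integrable_min.const_mul (4 + ‖ξ‖ ^ 2)).mono'
    ((continuous_charSubOne ξ).norm.pow 2).aestronglyMeasurable
    (Filter.Eventually.of_forall fun x => ?_)
  rw [Real.norm_of_nonneg (by positivity)]
  exact norm_charSubOne_sq_le ξ x

/-- The jump part of the kernel associated with the conditionally positive function `-ψ`. -/
noncomputable def levyKernel (m : Measure H) (ξ η : H) : ℂ :=
  ∫ x, conj (charSubOne ξ x) * charSubOne η x ∂m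

lemma IsLevyMeasure.levyKernel_eq (hm : IsLevyMeasure m) (ξ η : H) :
    levyKernel m ξ η = ∫ x, levyIntegrand (η - ξ) x ∂m - conj (∫ x, levyIntegrand ξ x ∂m)
      - ∫ x, levyIntegrand η x ∂m := by
  unfold levyKernel
  simp_rw [conj_charSubOne_mul_charSubOne]
  have h1 := hm.integrable_levyIntegrand (η - ξ)
  have h2 := hm.integrable_levyIntegrand ξ
  have h3 := hm.integrable_levyIntegrand η
  have h2' : Integrable (fun x => conj (levyIntegrand ξ x)) m :=
    (Complex.conjLIE.toContinuousLinearEquiv.toContinuousLinearMap).integrable_comp h2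
  rw [← integral_conj, ← integral_sub h1 h2']
  exact integral_sub (h1.sub h2') h3

-- The kernel is the Gram matrix of the centred characters in `L²(m)`.
open Matrix in
open scoped ComplexOrder in
lemma IsLevyMeasure.posSemidef_levyKernel (hm : IsLevyMeasure m) {ι : Type*} [Fintype ι]
    (ξ : ι → H) : (Matrix.of fun i j => levyKernel m (ξ i) (ξ j)).PosSemidef := by
  have h := posSemidef_gram ℂ fun i => (hm.memLp_charSubOne (ξ i)).toLp
  suffices e : (Matrix.of fun i j => levyKernel m (ξ i) (ξ j)) =
      gram ℂ fun i => (hm.memLp_charSubOne (ξ i)).toLp by rwa [e]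
  ext i j
  rw [Matrix.of_apply, gram_apply, L2.inner_def, levyKernel]
  refine integral_congr_ae ?_
  filter_upwards [(hm.memLp_charSubOne (ξ i)).coeFn_toLp,
    (hm.memLp_charSubOne (ξ j)).coeFn_toLp] with x hi hj
  rw [hi, hj, RCLike.inner_apply, mul_comm]

/-- The characteristic function of an infinitely divisible measure, at a difference. -/
lemma HasLevyTriplet.charFun_sub {μ : Measure H} {a : H} {R : H →L[ℝ] H}
    (h : HasLevyTriplet μ a R m) (ξ η : H) :
    charFun μ (η - ξ) = conj (charFun μ ξ) * charFun μ η *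
      Complex.exp ((⟪R ξ, η⟫ : ℝ) + levyKernel m ξ η) := by
  rw [h.charFun_eq, h.charFun_eq, h.charFun_eq, ← Complex.exp_conj, ← Complex.exp_add,
    ← Complex.exp_add, h.isLevyMeasure.levyKernel_eq]
  -- Compare exponents: the drift terms cancel, the quadratic form leaves its polarization `⟨R ξ,
  -- η⟩`, and `levyKernel_eq` accounts for the jump integrals.
  congr 1
  have hs : ⟪η, R ξ⟫ = ⟪R ξ, η⟫ := real_inner_comm _ _
  have hs' : ⟪ξ, R η⟫ = ⟪R ξ, η⟫ :=
    (h.isCovarianceOp.isPositive.inner_left_eq_inner_right ξ η).symm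
  have e : ∀ ζ, levySymbol a R m ζ = -(Complex.I * (⟪a, ζ⟫ : ℝ)) +
    (1 / 2 : ℂ) * (⟪ζ, R ζ⟫ : ℝ) - ∫ x, levyIntegrand ζ x ∂m := fun _ => rfl
  rw [e, e, e]
  simp only [map_sub, map_neg, map_add, map_mul, map_div₀, map_one, map_ofNat,
    Complex.conj_ofReal, Complex.conj_I, inner_sub_left, inner_sub_right, hs, hs',
    Complex.ofReal_sub]
  ring

end LevyKernel

/-! ### The inequality for trigonometric polynomials -/

section TrigonometricPolynomials

open ComplexConjugate Matrix
open scoped ComplexOrder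

variable {H : Type*} [NormedAddCommGroup H] [InnerProductSpace ℝ H]
  [MeasurableSpace H] [BorelSpace H] [SecondCountableTopology H]

omit [BorelSpace H] [SecondCountableTopology H] in
lemma levyKernel_zero_left (m : Measure H) (η : H) : levyKernel m 0 η = 0 := by
  simp [levyKernel, charSubOne]

/-- For the polynomial `∑ c j e^{i⟨ξ j, ·⟩}`, the left side is the squared change of its
`μ`-integral under translation by `S k`, and the last factor on the right is its variance. -/
lemma HasLevyTriplet.norm_sum_charFun_sq_le {μ : Measure H} {a : H} {R S : H →L[ℝ] H}
    {m : Measure H} (h : HasLevyTriplet μ a R m) (hS : S.IsPositive) (hSS : S ∘L S = R) (k : H)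
    {ι : Type*} [Fintype ι] (ξ : ι → H) (c : ι → ℂ) :
    ‖∑ j, c j * charFun μ (ξ j) * (Complex.exp (⟪S k, ξ j⟫ * Complex.I) - 1)‖ ^ 2 ≤
      (Real.exp (‖k‖ ^ 2) - 1) * ((∑ i, ∑ j, conj (c i) * c j * charFun μ (ξ j - ξ i)).re -
        ‖∑ j, c j * charFun μ (ξ j)‖ ^ 2) := by
  -- The index `none` carries `k` in the Gaussian Gram matrix and frequency `0` in the jump kernel,
  -- so its jump entries vanish. The phase `-i` in `d` turns the real entry `⟨k, S ξ j⟩` into `i⟨k,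
  -- S ξ j⟩`, as a character requires, and leaves the diagonal entry `‖k‖²` unchanged.
  set v : Option ι → H := fun o => o.elim k fun j => S (ξ j) with hv
  set ζ : Option ι → H := fun o => o.elim 0 ξ with hζ
  set d : Option ι → ℂ := fun o => o.elim (-Complex.I) fun _ => 1 with hd
  have hG := ((posSemidef_vecMulVec_star_self d).hadamard (posSemidef_gram ℝ v).map_ofReal).add
    (h.isLevyMeasure.posSemidef_levyKernel ζ)
  have key := hG.map_exp_sub_one.norm_sum_none_sq_le fun j => c j * charFun μ (ξ j)
  simp only [map_apply, Matrix.add_apply, hadamard_apply, vecMulVec_apply, gram_apply, of_apply,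
    Pi.star_apply, hv, hζ, hd, Option.elim, levyKernel_zero_left, add_zero, Complex.star_def,
    map_neg, Complex.conj_I, neg_neg, mul_one, map_one, one_mul] at key
  have hin : ∀ x y, ⟪S x, S y⟫ = ⟪R x, y⟫ := fun x y => by
    rw [← hSS, ← hS.inner_left_eq_inner_right]; rfl
  have e1 : ∀ j, (Complex.exp (Complex.I * (⟪k, S (ξ j)⟫ : ℝ)) - 1) * (c j * charFun μ (ξ j)) =
      c j * charFun μ (ξ j) * (Complex.exp (⟪S k, ξ j⟫ * Complex.I) - 1) := fun j => by
    rw [← hS.inner_left_eq_inner_right]; ring_nf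
  have e2 : Complex.exp (Complex.I * -Complex.I * (⟪k, k⟫ : ℝ)) - 1 =
      ((Real.exp (‖k‖ ^ 2) - 1 : ℝ) : ℂ) := by
    rw [real_inner_self_eq_norm_sq]; simp
  -- With weights `c j μ̂(ξ j)`, `charFun_sub` turns the form of `e^K - 1` into second moment minus
  -- squared modulus of the mean.
  have e3 : ∑ i, ∑ j, conj (c i * charFun μ (ξ i)) *
        (Complex.exp ((⟪S (ξ i), S (ξ j)⟫ : ℝ) + levyKernel m (ξ i) (ξ j)) - 1) *
        (c j * charFun μ (ξ j)) =
      ∑ i, ∑ j, conj (c i) * c j * charFun μ (ξ j - ξ i) -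
        ((‖∑ j, c j * charFun μ (ξ j)‖ ^ 2 : ℝ) : ℂ) := by
    push_cast
    rw [← Complex.conj_mul', map_sum, Finset.sum_mul_sum, ← Finset.sum_sub_distrib]
    refine Finset.sum_congr rfl fun i _ => ?_
    rw [← Finset.sum_sub_distrib]
    refine Finset.sum_congr rfl fun j _ => ?_
    rw [h.charFun_sub, hin, map_mul]
    ring
  simp only [e1] at key
  rw [e2, e3, Complex.ofReal_re, Complex.sub_re, Complex.ofReal_re] at key
  exact key

end TrigonometricPolynomials

/-! ### Density of trigonometric polynomials in `L²` -/

section Density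

open ComplexConjugate BoundedContinuousFunction

section Restriction

variable {X : Type*} [MeasurableSpace X] {μ ν : Measure X}

/-- The contraction `L²(ν) → L²(μ)` for `μ ≤ ν`. -/
noncomputable def lpOfLE (h : μ ≤ ν) : Lp ℂ 2 ν →L[ℂ] Lp ℂ 2 μ :=
  LinearMap.mkContinuous
    { toFun := fun G => ((Lp.memLp G).mono_measure h).toLp
      map_add' := fun F G => by
        rw [← MemLp.toLp_add]
        exact MemLp.toLp_congr _ _ ((Measure.absolutelyContinuous_of_le h).ae_eq
          (Lp.coeFn_add F G))
      map_smul' := fun c G => by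
        rw [RingHom.id_apply, ← MemLp.toLp_const_smul]
        exact MemLp.toLp_congr _ _ ((Measure.absolutelyContinuous_of_le h).ae_eq
          (Lp.coeFn_smul c G)) } 1 fun G => by
    rw [one_mul, LinearMap.coe_mk, AddHom.coe_mk, Lp.norm_toLp, Lp.norm_def]
    exact ENNReal.toReal_mono (Lp.memLp G).eLpNorm_ne_top (eLpNorm_mono_measure _ h)

lemma lpOfLE_toLp (h : μ ≤ ν) {g : X → ℂ} (hg : MemLp g 2 ν) :
    lpOfLE h hg.toLp = (hg.mono_measure h).toLp :=
  MemLp.toLp_congr ((Lp.memLp hg.toLp).mono_measure h) _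
    ((Measure.absolutelyContinuous_of_le h).ae_eq hg.coeFn_toLp)

lemma norm_toLp_ofReal_sq {g : X → ℝ} (hg : MemLp (fun x => (g x : ℂ)) 2 μ) :
    ‖hg.toLp‖ ^ 2 = ∫ x, g x ^ 2 ∂μ := by
  have h : ((‖hg.toLp‖ ^ 2 : ℝ) : ℂ) = ((∫ x, g x ^ 2 ∂μ : ℝ) : ℂ) := by
    have := inner_self_eq_norm_sq_to_K (𝕜 := ℂ) hg.toLp
    rw [Complex.ofReal_pow]
    refine this.symm.trans ?_
    rw [L2.inner_def, ← integral_complex_ofReal]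
    refine integral_congr_ae ?_
    filter_upwards [hg.coeFn_toLp] with x hx
    rw [hx, RCLike.inner_apply, Complex.conj_ofReal]
    push_cast
    ring
  exact_mod_cast h

end Restriction

variable {H : Type*} [NormedAddCommGroup H] [InnerProductSpace ℝ H] [MeasurableSpace H]
  [BorelSpace H]

/-- The character `x ↦ exp(i⟨x, ξ⟩)` as an element of `L²`. -/
noncomputable def charLp (ν : Measure H) [IsFiniteMeasure ν] (ξ : H) : Lp ℂ 2 ν :=
  BoundedContinuousFunction.toLp 2 ν ℂ (innerProbChar ξ)

lemma memLp_innerProbChar (ν : Measure H) [IsFiniteMeasure ν] (ξ : H) :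
    MemLp (innerProbChar ξ) 2 ν :=
  MemLp.of_bound (innerProbChar ξ).continuous.aestronglyMeasurable ‖innerProbChar ξ‖
    (Filter.Eventually.of_forall (innerProbChar ξ).norm_coe_le_norm)

lemma charLp_eq (ν : Measure H) [IsFiniteMeasure ν] (ξ : H) :
    charLp ν ξ = (memLp_innerProbChar ν ξ).toLp := by
  refine Lp.ext ?_
  exact (BoundedContinuousFunction.coeFn_toLp _ _ _ _).trans (MemLp.coeFn_toLp _).symm

lemma inner_charLp (ν : Measure H) [IsFiniteMeasure ν] (ξ η : H) :
    inner ℂ (charLp ν ξ) (charLp ν η) = charFun ν (η - ξ) := by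
  rw [charLp, charLp, BoundedContinuousFunction.inner_toLp, charFun_apply]
  refine integral_congr_ae (Filter.Eventually.of_forall fun x => ?_)
  simp only [innerProbChar_apply, ← Complex.exp_conj, map_mul, Complex.conj_I,
    Complex.conj_ofReal, inner_sub_right, ← Complex.exp_add]
  push_cast
  ring_nf

lemma inner_charLp_left (ν : Measure H) [IsFiniteMeasure ν] (ξ : H) (G : Lp ℂ 2 ν) :
    inner ℂ (charLp ν ξ) G = ∫ x, innerProbChar (-ξ) x * G x ∂ν := by
  rw [L2.inner_def]
  refine integral_congr_ae ?_
  filter_upwards [BoundedContinuousFunction.coeFn_toLp 2 ν ℂ (innerProbChar ξ)] with x hx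
  rw [charLp, hx, RCLike.inner_apply, mul_comm]
  simp [innerProbChar_apply, ← Complex.exp_conj]

variable [CompleteSpace H] [SecondCountableTopology H]

/-- An integrable real function whose Fourier transform vanishes is zero almost everywhere. -/
lemma ae_eq_zero_of_integral_innerProbChar_mul {ν : Measure H} {g : H → ℝ}
    (hg : Integrable g ν) (h : ∀ ξ, ∫ x, innerProbChar ξ x * (g x : ℂ) ∂ν = 0) :
    g =ᵐ[ν] 0 := by
  -- The positive and negative parts of `g` are densities of two finite measures with the same
  -- characteristic function, hence of the same measure.
  set p : Measure H := ν.withDensity fun x => ENNReal.ofReal (g x) with hp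
  set q : Measure H := ν.withDensity fun x => ENNReal.ofReal (-g x) with hq
  have : IsFiniteMeasure p := isFiniteMeasure_withDensity_ofReal hg.2
  have : IsFiniteMeasure q := isFiniteMeasure_withDensity_ofReal hg.neg.2
  have hint : ∀ (f : H → ℝ), Integrable f ν → ∀ ξ,
      charFun (ν.withDensity fun x => ENNReal.ofReal (f x)) ξ =
        ∫ x, innerProbChar ξ x * ((max (f x) 0 : ℝ) : ℂ) ∂ν := by
    intro f hf ξ
    rw [charFun_eq_integral_innerProbChar,
      integral_withDensity_eq_integral_toReal_smul₀ hf.1.aemeasurable.ennreal_ofReal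
        (Filter.Eventually.of_forall fun x => ENNReal.ofReal_lt_top)]
    refine integral_congr_ae (Filter.Eventually.of_forall fun x => ?_)
    simp only [ENNReal.toReal_ofReal', Complex.real_smul]
    ring
  have hI : ∀ (f : H → ℝ), Integrable f ν → ∀ ξ,
      Integrable (fun x => innerProbChar ξ x * ((max (f x) 0 : ℝ) : ℂ)) ν := fun f hf ξ =>
    hf.pos_part.ofReal.bdd_mul (innerProbChar ξ).continuous.aestronglyMeasurable
      (Filter.Eventually.of_forall (innerProbChar ξ).norm_coe_le_norm)
  have hpq : p = q := by
    refine Measure.ext_of_charFun (funext fun ξ => ?_)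
    rw [hp, hq, hint g hg, hint (fun x => -g x) hg.neg, ← sub_eq_zero,
      ← integral_sub (hI g hg ξ) (hI (fun x => -g x) hg.neg ξ), ← h ξ]
    refine integral_congr_ae (Filter.Eventually.of_forall fun x => ?_)
    simp only
    rw [← mul_sub, ← Complex.ofReal_sub]
    congr 2
    rcases le_total (g x) 0 with hx | hx
    · rw [max_eq_right hx, max_eq_left (by linarith)]; ring
    · rw [max_eq_left hx, max_eq_right (by linarith)]; ring
  have hae := (withDensity_eq_iff hg.1.aemeasurable.ennreal_ofReal
    hg.1.aemeasurable.neg.ennreal_ofReal ?_).1 hpq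
  · filter_upwards [hae] with x hx
    rcases lt_trichotomy (g x) 0 with h0 | h0 | h0
    · rw [ENNReal.ofReal_of_nonpos h0.le] at hx
      exact absurd hx.symm (by simpa using h0)
    · exact h0
    · have : ENNReal.ofReal (-g x) = 0 := ENNReal.ofReal_of_nonpos (by linarith)
      rw [Pi.neg_apply, this] at hx
      exact absurd hx (by simpa using h0)
  · exact hg.lintegral_lt_top.ne

/-- Trigonometric polynomials are dense in `L²` of a finite measure. -/
lemma topologicalClosure_span_charLp (ν : Measure H) [IsFiniteMeasure ν] :
    (Submodule.span ℂ (Set.range (charLp ν))).topologicalClosure = ⊤ := by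
  rw [Submodule.topologicalClosure_eq_top_iff, Submodule.eq_bot_iff]
  intro G hG
  have h0 : ∀ ξ, ∫ x, innerProbChar ξ x * G x ∂ν = 0 := fun ξ => by
    have h := hG _ (Submodule.subset_span ⟨-ξ, rfl⟩)
    rwa [inner_charLp_left, neg_neg] at h
  have hGi : Integrable (fun x => G x) ν := (Lp.memLp G).integrable one_le_two
  have hGc : Integrable (fun x => conj (G x)) ν :=
    Complex.conjLIE.toContinuousLinearEquiv.toContinuousLinearMap.integrable_comp hGi
  have hb : ∀ ξ {F : H → ℂ}, Integrable F ν → Integrable (fun x => innerProbChar ξ x * F x) ν :=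
    fun ξ F hF => hF.bdd_mul (innerProbChar ξ).continuous.aestronglyMeasurable
      (Filter.Eventually.of_forall (innerProbChar ξ).norm_coe_le_norm)
  -- Conjugating the relation at `-ξ` shows that `conj G` also has zero transform. The real and
  -- imaginary parts can therefore be treated separately.
  have h1 : ∀ ξ, ∫ x, innerProbChar ξ x * conj (G x) ∂ν = 0 := fun ξ => by
    have h := congrArg conj (h0 (-ξ))
    rw [← integral_conj, map_zero] at h
    rw [← h]
    refine integral_congr_ae (Filter.Eventually.of_forall fun x => ?_)
    simp [innerProbChar_apply, ← Complex.exp_conj]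
  have hre : (fun x => (G x).re) =ᵐ[ν] 0 := by
    refine ae_eq_zero_of_integral_innerProbChar_mul hGi.re fun ξ => ?_
    have e : ∀ x, innerProbChar ξ x * ((G x).re : ℂ) =
        (1 / 2 : ℂ) * (innerProbChar ξ x * G x + innerProbChar ξ x * conj (G x)) := fun x => by
      rw [Complex.re_eq_add_conj]; ring
    simp_rw [e]
    rw [integral_const_mul, integral_add (hb ξ hGi) (hb ξ hGc), h0, h1]
    simp
  have him : (fun x => (G x).im) =ᵐ[ν] 0 := by
    refine ae_eq_zero_of_integral_innerProbChar_mul hGi.im fun ξ => ?_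
    have e : ∀ x, innerProbChar ξ x * ((G x).im : ℂ) =
        (1 / (2 * Complex.I)) *
          (innerProbChar ξ x * G x - innerProbChar ξ x * conj (G x)) := fun x => by
      rw [Complex.im_eq_sub_conj]; ring
    simp_rw [e]
    rw [integral_const_mul, integral_sub (hb ξ hGi) (hb ξ hGc), h0, h1]
    simp
  refine Lp.ext ?_
  filter_upwards [hre, him, Lp.coeFn_zero ℂ 2 ν] with x h2 h3 h4
  rw [h4]
  exact Complex.ext h2 h3

end Density

/-! ### From trigonometric polynomials to bounded Borel functions -/

section Variance

open ComplexConjugate BoundedContinuousFunction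

variable {H : Type*} [NormedAddCommGroup H] [InnerProductSpace ℝ H] [MeasurableSpace H]
  [BorelSpace H]

lemma lpOfLE_charLp {μ ν : Measure H} [IsFiniteMeasure μ] [IsFiniteMeasure ν] (h : μ ≤ ν)
    (ξ : H) : lpOfLE h (charLp ν ξ) = charLp μ ξ := by
  rw [charLp_eq, charLp_eq, lpOfLE_toLp]

/-- The character of frequency `0` is the constant `1`, so pairing with it integrates. Means thereby
become continuous functionals on `L²`. -/
lemma inner_charLp_zero_toLp {μ : Measure H} [IsFiniteMeasure μ] {g : H → ℝ}
    (hg : MemLp (fun x => (g x : ℂ)) 2 μ) :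
    inner ℂ (charLp μ 0) hg.toLp = ((∫ x, g x ∂μ : ℝ) : ℂ) := by
  rw [inner_charLp_left, ← integral_complex_ofReal]
  refine integral_congr_ae ?_
  filter_upwards [hg.coeFn_toLp] with x hx
  rw [hx]
  simp

variable [CompleteSpace H] [SecondCountableTopology H]

/-- Quasi-invariance estimate: translating an infinitely divisible measure with Gaussian
covariance `R = S²` by `S k` changes the integral of a bounded function by at most
`(exp(|k|²) - 1)^{1/2}` times its standard deviation. -/
lemma HasLevyTriplet.abs_integral_translate_sub_sq_le {μ : Measure H} {a : H}
    {R S : H →L[ℝ] H} {m : Measure H} (hμ : HasLevyTriplet μ a R m) (hS : S.IsPositive)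
    (hSS : S ∘L S = R) (k : H) {g : H → ℝ} (hg : Measurable g) (hb : ∃ C, ∀ x, |g x| ≤ C) :
    |∫ x, g (x + S k) ∂μ - ∫ x, g x ∂μ| ^ 2 ≤
      (Real.exp (‖k‖ ^ 2) - 1) * (∫ x, g x ^ 2 ∂μ - (∫ x, g x ∂μ) ^ 2) := by
  have := hμ.isProbabilityMeasure
  set μ' : Measure H := μ.map (· + S k) with hμ'
  have : IsProbabilityMeasure μ' := Measure.isProbabilityMeasure_map (by fun_prop)
  -- `ν` dominates both `μ` and its translate, so one approximation in `L²(ν)` controls both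
  -- integrals.
  set ν : Measure H := μ + μ' with hν
  have h1 : μ ≤ ν := Measure.le_add_right le_rfl
  have h2 : μ' ≤ ν := Measure.le_add_left le_rfl
  have key : ∀ G : Lp ℂ 2 ν, ‖inner ℂ (charLp μ' 0) (lpOfLE h2 G) -
      inner ℂ (charLp μ 0) (lpOfLE h1 G)‖ ^ 2 ≤ (Real.exp (‖k‖ ^ 2) - 1) *
        (‖lpOfLE h1 G‖ ^ 2 - ‖inner ℂ (charLp μ 0) (lpOfLE h1 G)‖ ^ 2) := by
    have hd : Dense ((Submodule.span ℂ (Set.range (charLp ν)) : Submodule ℂ (Lp ℂ 2 ν)) :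
        Set (Lp ℂ 2 ν)) :=
      Submodule.dense_iff_topologicalClosure_eq_top.2 (topologicalClosure_span_charLp ν)
    refine fun G => hd.induction (P := fun G : Lp ℂ 2 ν => ‖inner ℂ (charLp μ' 0) (lpOfLE h2 G) -
      inner ℂ (charLp μ 0) (lpOfLE h1 G)‖ ^ 2 ≤ (Real.exp (‖k‖ ^ 2) - 1) *
        (‖lpOfLE h1 G‖ ^ 2 - ‖inner ℂ (charLp μ 0) (lpOfLE h1 G)‖ ^ 2)) ?_ ?_ G
    · intro G hG
      obtain ⟨c, rfl⟩ := (Finsupp.mem_span_range_iff_exists_finsupp).1 hG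
      have h := hμ.norm_sum_charFun_sq_le hS hSS k (ι := c.support) (fun j => (j : H))
        fun j => c j
      have hJ : ∀ {κ : Measure H} [IsFiniteMeasure κ] (hκ : κ ≤ ν),
          lpOfLE hκ (c.sum fun ξ z => z • charLp ν ξ) =
            ∑ j : c.support, c j • charLp κ (j : H) := fun hκ => by
        rw [Finsupp.sum, map_sum, ← Finset.sum_coe_sort]
        simp only [map_smul, lpOfLE_charLp]
      have hI : ∀ {κ : Measure H} [IsFiniteMeasure κ] (hκ : κ ≤ ν),
          inner ℂ (charLp κ 0) (lpOfLE hκ (c.sum fun ξ z => z • charLp ν ξ)) =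
            ∑ j : c.support, c j * charFun κ (j : H) := fun hκ => by
        rw [hJ hκ, inner_sum]
        simp only [inner_smul_right, inner_charLp, sub_zero]
      have hN : ‖lpOfLE h1 (c.sum fun ξ z => z • charLp ν ξ)‖ ^ 2 =
          (∑ i : c.support, ∑ j : c.support,
            conj (c i) * c j * charFun μ ((j : H) - (i : H))).re := by
        rw [← inner_self_eq_norm_sq (𝕜 := ℂ), hJ h1, sum_inner]
        simp only [inner_sum, inner_smul_left, inner_smul_right, inner_charLp]
        simp only [mul_assoc, RCLike.re_eq_complex_re]
        congr 1
        refine Finset.sum_congr rfl fun i _ => Finset.sum_congr rfl fun j _ => ?_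
        ring
      rw [hI h1, hI h2, hN, ← Finset.sum_sub_distrib]
      refine le_trans (le_of_eq ?_) h
      congr 2
      refine Finset.sum_congr rfl fun j _ => ?_
      -- Translation by `S k` multiplies the characteristic function by `exp(i⟨S k, ξ⟩)`.
      rw [hμ', charFun_map_add_const]
      ring
    -- Restriction to `μ` and `μ'` is continuous on `L²(ν)`, so the inequality is a closed
    -- condition.
    · exact isClosed_le (by fun_prop) (by fun_prop)
  obtain ⟨C, hC⟩ := hb
  have hm : ∀ (κ : Measure H) [IsFiniteMeasure κ], MemLp (fun x => (g x : ℂ)) 2 κ := fun κ _ =>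
    MemLp.of_bound (by fun_prop) C (Filter.Eventually.of_forall fun x => by simpa using hC x)
  have h := key (hm ν).toLp
  rw [lpOfLE_toLp, lpOfLE_toLp, inner_charLp_zero_toLp, inner_charLp_zero_toLp,
    norm_toLp_ofReal_sq, ← Complex.ofReal_sub, Complex.norm_real, Complex.norm_real,
    Real.norm_eq_abs, Real.norm_eq_abs, sq_abs (∫ x, g x ∂μ), hμ',
    integral_map (by fun_prop) (by fun_prop)] at h
  exact h

lemma HasLevyTriplet.abs_integral_add_sub_sq_le {μ : Measure H} {a : H}
    {R S : H →L[ℝ] H} {m : Measure H} (hμ : HasLevyTriplet μ a R m) (hS : S.IsPositive)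
    (hSS : S ∘L S = R) {k u v : H} (huv : u - v = S k) {f : H → ℝ} (hf : Measurable f)
    (hb : ∃ C, ∀ x, |f x| ≤ C) :
    |∫ z, f (u + z) ∂μ - ∫ z, f (v + z) ∂μ| ^ 2 ≤
      (Real.exp (‖k‖ ^ 2) - 1) * (∫ z, f (v + z) ^ 2 ∂μ - (∫ z, f (v + z) ∂μ) ^ 2) := by
  obtain ⟨C, hC⟩ := hb
  have h := hμ.abs_integral_translate_sub_sq_le hS hSS k (g := fun z => f (v + z))
    (by fun_prop) ⟨C, fun z => hC _⟩
  have e : ∀ z, v + (z + S k) = u + z := fun z => by rw [← huv]; abel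
  simpa only [e] using h

end Variance
end Mehler

theorem mainTheorem12 {H : Type*} [NormedAddCommGroup H] [InnerProductSpace ℝ H]
    [CompleteSpace H] [TopologicalSpace.SeparableSpace H] [MeasurableSpace H] [BorelSpace H]
    (U : ℝ → ℝ → H →L[ℝ] H) (hU : Mehler.IsEvolutionFamily U)
    (μ : ℝ → ℝ → Measure H) (hμ : Mehler.IsSkewConvolution U μ)
    (a : ℝ → ℝ → H) (R : ℝ → ℝ → H →L[ℝ] H) (m : ℝ → ℝ → Measure H)
    (hD : ∀ s t, s ≤ t → Mehler.HasLevyTriplet (μ t s) (a t s) (R t s) (m t s))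
    (f : H → ℝ) (hf : Measurable f) (hfb : ∃ C, ∀ x, |f x| ≤ C)
    (s t : ℝ) (hst : s < t) (x y : H)
    (hxy : x - y ∈ Mehler.gammaDomain U R t s) :
    |Mehler.mehler U μ s t f x - Mehler.mehler U μ s t f y| ^ 2 ≤
      (Real.exp (‖Mehler.gammaOp U R t s (x - y)‖ ^ 2) - 1) *
        min (Mehler.mehler U μ s t (fun z => f z ^ 2) x - Mehler.mehler U μ s t f x ^ 2)
          (Mehler.mehler U μ s t (fun z => f z ^ 2) y - Mehler.mehler U μ s t f y ^ 2) := by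
  have : SecondCountableTopology H := UniformSpace.secondCountable_of_separable H
  have h := hD s t hst.le
  have hS := Mehler.sqrtOp_isPositive h.isCovarianceOp.isPositive
  have hSS := Mehler.sqrtOp_comp_self h.isCovarianceOp.isPositive
  have hk : U t s x - U t s y =
      Mehler.sqrtOp (R t s) (Mehler.gammaOp U R t s (x - y)) := by
    rw [← map_sub]
    exact (Mehler.apply_pinv hxy).symm
  -- Exchanging `x` and `y` replaces `k` by `-k`, which has the same norm. The base point of the
  -- variance moves from `y` to `x`.
  have hk' : U t s y - U t s x =
      Mehler.sqrtOp (R t s) (-Mehler.gammaOp U R t s (x - y)) := by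
    rw [map_neg, ← hk, neg_sub]
  rcases min_choice (Mehler.mehler U μ s t (fun z => f z ^ 2) x - Mehler.mehler U μ s t f x ^ 2)
    (Mehler.mehler U μ s t (fun z => f z ^ 2) y - Mehler.mehler U μ s t f y ^ 2) with e | e <;>
    rw [e]
  · have h1 := h.abs_integral_add_sub_sq_le hS hSS hk' hf hfb
    rwa [norm_neg, abs_sub_comm] at h1
  · exact h.abs_integral_add_sub_sq_le hS hSS hk hf hfb
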